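/- **Setting.** Let $\mathcal X$ be a measurable space, $\mathcal Y=\{-1,1\}$, and let $(X,Y)\sim\mathbb P$ be a probability distribution on $\mathcal X\times\mathcal Y$. A differentiable function $\phi:\mathbb R\to[0,\infty)$ is an *Arch boosting loss* if (i) $\inf_v\phi(v)=0$; (ii) for every $0<\alpha<1$ the function $v\mapsto\alpha\phi(v)+(1-\alpha)\phi(-v)$ has exactly one critical point, and this point is its global minimum; (iii) for every $0\le\alpha\le1$ with $\alpha\ne\frac12$, $\inf\{\alpha\phi(v)+(1-\alpha)\phi(-v):v(2\alpha-1)\le0\}>\inf\{\alpha\phi(v)+(1-\alpha)\phi(-v):v\in\mathbb R\}$. Write $\phi(y,v)=\phi(yv)$, $\phi'(y,v)=\partial_v\phi(y,v)$, $\phi''(y,v)=\partial_v^2\phi(y,v)$, and for $p\in(0,1)$ let $v_p^*$ be the global minimizer of $v\mapsto p\,\phi(1,v)+(1-p)\,\phi(-1,v)$. Let $H$ be a real reproducing kernel Hilbert space of measurable functions on $\mathcal X$ with bounded kernel $k$, $|k(x,x')|\le M_k$ for all $x,x'\in\mathcal X$, and let $\Psi(x)=k(x,\cdot)\in H$. For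 $\lambda>0$ let $T$ assign to every probability distribution $\mathbb Q$ on $\mathcal X\times\mathcal Y$ a global minimizer $T(\mathbb Q)=f_{\mathbb Q,\lambda}$ over $f\in H$ of $\mathbb E_{\mathbb Q}[\phi(Y,f(X))]+\lambda\|f\|_H^2$, where at $\mathbb Q=\mathbb P$ the global minimizer $f_{\mathbb P,\lambda}$ is assumed to be unique. For $z=(z_x,z_y)\in\mathcal X\times\mathcal Y$ the influence function of $T$ at $\mathbb P$ is the limit in $H$ $$IF(z)=\lim_{\epsilon\to0^+}\frac{T((1-\epsilon)\mathbb P+\epsilon\Delta_z)-T(\mathbb P)}{\epsilon},$$ where $\Delta_z$ is the Dirac distribution at $z$. **Theorem.** Let $\phi$ be a twice continuously differentiable Arch boosting loss and let $H$, $k$, $M_k$ be as above. Assume that for some $0<\delta<\frac12$ there is a version $p_x$ of $\mathbb P(Y=1\mid X=x)$ with $p_x\in[\delta,1-\delta]$ for all $x\in\mathcal X$, and that $p\,\phi''(1,v_p^*)+(1-p)\,\phi''(-1,v_p^*)>0$ for all $p\in[\delta,1-\delta]$. Let $F^*(x)=v^*_{p_x}$. Then there is $r>0$ such that for every $\lambda>0$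 and every $T$ as above with $|f_{\mathbb P,\lambda}(X)-F^*(X)|<r$ almost surely (in particular, if $\|f_{\mathbb P,\lambda}-F^*\|_\infty<r$): 1. $IF(z)$ exists for every $z\in\mathcal X\times\mathcal Y$, and it is the unique solution $g\in H$ of $Sg=-J$, where $$S=\mathbb E_{\mathbb P}\big[\phi''(Y,f_{\mathbb P,\lambda}(X))\langle\Psi(X),\cdot\rangle\Psi(X)\big]+2\lambda\,\mathrm{id}_H,\qquad J=\phi'(z_y,f_{\mathbb P,\lambda}(z_x))\Psi(z_x)-\mathbb E_{\mathbb P}\big[\phi'(Y,f_{\mathbb P,\lambda}(X))\Psi(X)\big],$$ with $H$-valued expectations understood in the weak sense. 2. With $C_\phi=\phi(0,0)$, for every $z$, $$\|IF(z)\|_H\le\sqrt{\frac{C_\phi}{\lambda}}+\frac{\sqrt{M_k}\,|\phi'(z_y,f_{\mathbb P,\lambda}(z_x))|}{2\lambda},$$ and hence, if $M_k\ge1$, $$\|IF(z)\|_H\le\sqrt{\frac{C_\phi}{\lambda}}+\frac{M_k\,|\phi'(z_y,f_{\mathbb P,\lambda}(z_x))|}{2\lambda}.$$ 3. In particular $\sup_z\|IF(z)\|_H<\infty$;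 and if $\tau,R\in\mathbb R$ are such that $|\phi'(v)|\le\tau$ whenever $|v|\ge R$, then $\|IF(z)\|_H\le\sqrt{C_\phi/\lambda}+\sqrt{M_k}\,\tau/(2\lambda)$ for every $z$ with $|z_yf_{\mathbb P,\lambda}(z_x)|\ge R$. (So, when $\phi'$ decays at $\pm\infty$, the part of the bound due to $z$ becomes small for gross outliers.) -/

import Mathlib

open MeasureTheory ProbabilityTheory Filter Topology

noncomputable section

namespace ArchBoost

/-- The set of class labels `{-1, 1}`. -/
abbrev Label : Type := ↥({-1, 1} : Set ℝ)

/-- The mixture `α φ(v) + (1 - α) φ(-v)`, the conditional `φ`-risk at class probability `α`. -/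
def condRisk (φ : ℝ → ℝ) (α v : ℝ) : ℝ := α * φ v + (1 - α) * φ (-v)

/-- Arch boosting loss functions. -/
structure IsArchLoss (φ : ℝ → ℝ) : Prop where
  differentiable : Differentiable ℝ φ
  nonneg : ∀ v, 0 ≤ φ v
  iInf_eq_zero : ⨅ v, φ v = 0
  /-- `α φ(v) + (1 - α) φ(-v)` has exactly one critical point, and it is the global minimum. -/
  unique_critical : ∀ α : ℝ, 0 < α → α < 1 →
    ∃ v : ℝ, deriv (condRisk φ α) v = 0 ∧ (∀ w, deriv (condRisk φ α) w = 0 → w = v) ∧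
      ∀ w, condRisk φ α v ≤ condRisk φ α w
  /-- Classification calibration. -/
  calibrated : ∀ α : ℝ, 0 ≤ α → α ≤ 1 → α ≠ 1 / 2 →
    sInf (condRisk φ α '' {v : ℝ | v * (2 * α - 1) ≤ 0}) > ⨅ v, condRisk φ α v

/-- The loss as a function `φ(y, v) = φ(y v)` of the label and the predicted value. -/
def loss (φ : ℝ → ℝ) (y v : ℝ) : ℝ := φ (y * v)

/-- `φ'(y, v) = ∂/∂v φ(y, v)`. -/
def lossD (φ : ℝ → ℝ) (y v : ℝ) : ℝ := deriv (fun w => loss φ y w) v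

/-- `φ''(y, v) = ∂²/∂v² φ(y, v)`. -/
def lossD2 (φ : ℝ → ℝ) (y v : ℝ) : ℝ := deriv (fun w => lossD φ y w) v

/-- `v` is a global minimum of `p φ(1, ·) + (1 - p) φ(-1, ·)`. -/
def IsPointwiseMin (φ : ℝ → ℝ) (p v : ℝ) : Prop :=
  ∀ w : ℝ, p * loss φ 1 v + (1 - p) * loss φ (-1) v ≤ p * loss φ 1 w + (1 - p) * loss φ (-1) w

section

variable {𝒳 : Type*} [MeasurableSpace 𝒳]

/-- `η x = P(Y = 1 | X = x)`: `η` is a version of the conditional class probability. -/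
def IsClassProb (P : Measure (𝒳 × Label)) (η : 𝒳 → ℝ) : Prop :=
  Measurable η ∧
    (fun z : 𝒳 × Label => η z.1) =ᵐ[P]
      P⟦{z : 𝒳 × Label | (z.2 : ℝ) = 1} | MeasurableSpace.comap Prod.fst inferInstance⟧

/-- The contaminated distribution `(1 - ε) P + ε Δ_z`. -/
def contaminate (P : Measure (𝒳 × Label)) (z : 𝒳 × Label) (ε : ℝ) : Measure (𝒳 × Label) :=
  ENNReal.ofReal (1 - ε) • P + ENNReal.ofReal ε • Measure.dirac z

variable {H : Type*} [NormedAddCommGroup H] [InnerProductSpace ℝ H]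

/-- `g` is the influence function of the statistical functional `T` at the distribution `P`
and the contamination point `z`: the one-sided Gâteaux derivative of `T` along the
contaminations of `P` at `z` exists and equals `g`. -/
def HasInfluence (T : Measure (𝒳 × Label) → H) (P : Measure (𝒳 × Label)) (z : 𝒳 × Label)
    (g : H) : Prop :=
  Tendsto (fun ε : ℝ => ε⁻¹ • (T (contaminate P z ε) - T P)) (𝓝[>] 0) (𝓝 g)

variable [RKHS ℝ H 𝒳 ℝ]

/-- The regularized risk `E_Q[φ(Y, f(X))] + lam ‖f‖²`. -/
def regRisk (φ : ℝ → ℝ) (lam : ℝ) (Q : Measure (𝒳 × Label)) (f : H) : ℝ :=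
  (∫ w, loss φ w.2 (f w.1) ∂Q) + lam * ‖f‖ ^ 2

/-- `f` is a global minimizer over `H` of the regularized risk. -/
def IsRegMinimizer (φ : ℝ → ℝ) (lam : ℝ) (Q : Measure (𝒳 × Label)) (f : H) : Prop :=
  ∀ g : H, regRisk φ lam Q f ≤ regRisk φ lam Q g

/-- The equation `S g = -J` in `H`, where
`S = E_P[φ''(Y, f(X)) ⟨Ψ(X), ·⟩ Ψ(X)] + 2 lam id` and
`J = φ'(z_y, f(z_x)) Ψ(z_x) - E_P[φ'(Y, f(X)) Ψ(X)]` with `Ψ(x) = k(x, ·)`.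
The `H`-valued expectations are taken in the weak sense: both sides are paired with an
arbitrary `h` in `H`, and `⟨Ψ(x), h⟩ = h x`. -/
def SolvesInfluenceEq (φ : ℝ → ℝ) (lam : ℝ) (P : Measure (𝒳 × Label)) (f : H) (z : 𝒳 × Label)
    (g : H) : Prop :=
  ∀ h : H,
    (∫ w, lossD2 φ w.2 (f w.1) * g w.1 * h w.1 ∂P) + 2 * lam * inner ℝ g h =
      -(lossD φ z.2 (f z.1) * h z.1 - ∫ w, lossD φ w.2 (f w.1) * h w.1 ∂P)

end

end ArchBoost

end

/-!
The regularized risk `E[φ(Y, f(X))] + lam ‖f‖²` need not be convex in `f`, but near the pointwise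
risk minimizer its second derivative is at least `2 lam`, and this local fact suffices.

The radius `r`. For each class probability `p` the conditional risk has a single critical point,
its minimum; by Rolle's theorem the risk never comes back to its minimal value, not even at
infinity (`exists_gap_of_unique_critical`). Hence the minimizer is continuous in `p`, the
minimizers over `[δ, 1 - δ]` form a compact graph, and the positivity of the second derivative
extends to a uniform neighbourhood of that graph (`IsArchLoss.exists_radius`). If `f_P` is almost
surely within `r` of the minimizers, then conditioning on `X` makes the loss part of the second
derivative nonnegative (`coercive_hessianForm`), so that the Lax–Milgram theorem yields a unique
solution of `S g = -J` (`existsUnique_solvesInfluenceEq`).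

Convergence of the contaminated minimizers. They are bounded in norm, by comparison with `0`, and
the risk is weakly sequentially continuous on bounded sets. A weak limit is therefore a minimizer
for `P`, that is, `f_P`; comparing regularized risks gives convergence of norms and hence strong
convergence (`tendsto_minimizer`).

Differentiation. With `d = f_{P_ε} - f_P`, the difference of the two Euler–Lagrange equations is
the linear equation for `d`, with an error `o(‖d‖) + o(ε)`; coercivity then gives
`‖d - ε g‖ = o(ε)` (`hasInfluence_of_solvesInfluenceEq`). The norm bound comes from testing the
equation for `g` against `g`, with the mean of `φ'` replaced through the Euler–Lagrange equation
by `-2 lam ⟨f_P, g⟩` (`norm_le_of_solvesInfluenceEq`).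
-/

namespace ArchBoost

/-! ### Scalar loss functions -/

lemma hasDerivAt_condRisk {φ : ℝ → ℝ} (hφ : Differentiable ℝ φ) (α v : ℝ) :
    HasDerivAt (condRisk φ α) (α * deriv φ v - (1 - α) * deriv φ (-v)) v := by
  have h1 := (hφ v).hasDerivAt.const_mul α
  have h2 := (((hφ (-v)).hasDerivAt).comp v (hasDerivAt_neg v)).const_mul (1 - α)
  exact (h1.add h2).congr_deriv (by ring)

lemma isPointwiseMin_iff {φ : ℝ → ℝ} {p v : ℝ} :
    IsPointwiseMin φ p v ↔ ∀ w, condRisk φ p v ≤ condRisk φ p w := by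
  simp [IsPointwiseMin, condRisk, loss]

/-- To the right of a point `a` beyond the only critical point `v`, a global minimum, the values
are at least `g a`: a smaller value would also be taken between `v` and `a`, and Rolle's theorem
would give a second critical point. -/
lemma le_of_unique_critical {g : ℝ → ℝ} (hg : Differentiable ℝ g) {v : ℝ}
    (hcrit : ∀ w, deriv g w = 0 → w = v) (hmin : ∀ w, g v ≤ g w) {a w : ℝ}
    (ha : v < a) (hw : a ≤ w) : g a ≤ g w := by
  by_contra! hlt
  obtain ⟨u, hu, hgu⟩ : g w ∈ g '' Set.Icc v a :=
    intermediate_value_Icc ha.le hg.continuous.continuousOn ⟨hmin w, hlt.le⟩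
  have huw : u < w := by
    rcases hw.eq_or_lt with rfl | h
    · exact absurd hlt (lt_irrefl _)
    · exact hu.2.trans_lt h
  obtain ⟨c, hc, hc0⟩ := exists_deriv_eq_zero huw hg.continuous.continuousOn hgu
  have := hcrit c hc0
  have h1 := hu.1
  have h2 := hc.1
  linarith

lemma lt_of_unique_critical {g : ℝ → ℝ} {v : ℝ}
    (hcrit : ∀ w, deriv g w = 0 → w = v) (hmin : ∀ w, g v ≤ g w) {a : ℝ}
    (ha : a ≠ v) : g v < g a := by
  refine (hmin a).lt_of_ne fun h => ha (hcrit a ?_)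
  have : IsLocalMin g a := Eventually.of_forall fun w => h ▸ hmin w
  exact this.deriv_eq_zero

/-- A global minimum that is the only critical point is well separated. -/
lemma exists_gap_of_unique_critical {g : ℝ → ℝ} (hg : Differentiable ℝ g) {v : ℝ}
    (hcrit : ∀ w, deriv g w = 0 → w = v) (hmin : ∀ w, g v ≤ g w) {ε : ℝ} (hε : 0 < ε) :
    ∃ κ > 0, ∀ w, ε ≤ |w - v| → g v + κ ≤ g w := by
  have h1 := lt_of_unique_critical hcrit hmin (a := v + ε) (by linarith)
  have h2 := lt_of_unique_critical hcrit hmin (a := v - ε) (by linarith)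
  refine ⟨min (g (v + ε)) (g (v - ε)) - g v, by simp [h1, h2], fun w hw => ?_⟩
  rw [add_sub_cancel]
  rcases le_abs.1 hw with h | h
  · exact (min_le_left _ _).trans
      (le_of_unique_critical hg hcrit hmin (by linarith) (by linarith))
  · -- the left half-line is reduced to the right one by reflection
    have hcrit' : ∀ w, deriv (fun x => g (-x)) w = 0 → w = -v := fun w h0 => by
      rw [deriv_comp_neg, neg_eq_zero] at h0
      linarith [hcrit _ h0]
    have := le_of_unique_critical (g := fun x => g (-x)) (hg.comp differentiable_neg) hcrit'
      (fun w => by simpa using hmin (-w)) (a := -v + ε) (w := -w) (by linarith) (by linarith)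
    simp only [neg_add, neg_neg] at this
    exact (min_le_right _ _).trans (by simpa [sub_eq_add_neg] using this)

section Loss

variable {φ : ℝ → ℝ}

lemma IsArchLoss.critical_of_isPointwiseMin (hφ : IsArchLoss φ) {p v : ℝ} (hp0 : 0 < p)
    (hp1 : p < 1) (hv : IsPointwiseMin φ p v) :
    ∀ w, deriv (condRisk φ p) w = 0 → w = v := by
  obtain ⟨u, -, hu, -⟩ := hφ.unique_critical p hp0 hp1
  have hv0 : deriv (condRisk φ p) v = 0 :=
    IsLocalMin.deriv_eq_zero (Eventually.of_forall (isPointwiseMin_iff.1 hv))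
  intro w hw
  rw [hu w hw, hu v hv0]

/-- The risk minimizer depends continuously on the class probability. -/
lemma IsArchLoss.continuousOn_minimizer (hφ : IsArchLoss φ) {δ : ℝ} (hδ0 : 0 < δ)
    {s : ℝ → ℝ} (hs : ∀ p ∈ Set.Icc δ (1 - δ), IsPointwiseMin φ p (s p)) :
    ContinuousOn s (Set.Icc δ (1 - δ)) := by
  intro p hp
  have hmin := isPointwiseMin_iff.1 (hs p hp)
  have hd : Differentiable ℝ (condRisk φ p) :=
    fun v => (hasDerivAt_condRisk hφ.differentiable p v).differentiableAt
  rw [ContinuousWithinAt, Metric.tendsto_nhdsWithin_nhds]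
  intro ε hε
  obtain ⟨κ, hκ, hgap⟩ := exists_gap_of_unique_critical hd
    (hφ.critical_of_isPointwiseMin (hδ0.trans_le hp.1) (by linarith [hp.2]) (hs p hp)) hmin hε
  -- `φ(v)` and `φ(-v)` are at most `φ(0)/δ` at minimizers, so `|φ(v) - φ(-v)| ≤ C` there
  set C := φ 0 / δ with hC
  have hC0 : 0 ≤ C := div_nonneg (hφ.nonneg 0) hδ0.le
  have hbd : ∀ q ∈ Set.Icc δ (1 - δ), |φ (s q) - φ (-(s q))| ≤ C := by
    intro q hq
    have h0 := isPointwiseMin_iff.1 (hs q hq) 0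
    simp only [condRisk, neg_zero] at h0
    have hn1 := hφ.nonneg (s q)
    have hn2 := hφ.nonneg (-(s q))
    have e1 : φ (s q) ≤ C := by
      rw [hC, le_div_iff₀ hδ0]
      nlinarith [hq.1, hq.2, mul_nonneg (by linarith [hq.2] : 0 ≤ 1 - q) hn2]
    have e2 : φ (-(s q)) ≤ C := by
      rw [hC, le_div_iff₀ hδ0]
      nlinarith [hq.1, hq.2, mul_nonneg (by linarith [hq.1] : 0 ≤ q) hn1]
    rw [abs_le]
    constructor <;> linarith
  refine ⟨κ / (2 * C + 1), by positivity, fun q hq hqp => ?_⟩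
  rw [Real.dist_eq] at hqp ⊢
  by_contra! hfar
  have h1 := hgap _ hfar
  have h2 := isPointwiseMin_iff.1 (hs q hq) (s p)
  have h3 : ∀ v, condRisk φ p v - condRisk φ q v = (p - q) * (φ v - φ (-v)) := fun v => by
    simp only [condRisk]; ring
  have h4 : ∀ r ∈ Set.Icc δ (1 - δ), |(p - q) * (φ (s r) - φ (-(s r)))| ≤ |q - p| * C := by
    intro r hr
    rw [abs_mul, abs_sub_comm p q]
    exact mul_le_mul_of_nonneg_left (hbd r hr) (abs_nonneg _)
  have h5 := abs_le.1 ((h3 (s q)).symm ▸ h4 q hq)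
  have h6 := abs_le.1 ((h3 (s p)).symm ▸ h4 p hp)
  rw [lt_div_iff₀ (by positivity)] at hqp
  nlinarith [h5.2, h6.1, abs_nonneg (q - p)]

lemma lossD_eq (y v : ℝ) : lossD φ y v = y * deriv φ (y * v) := by
  simp only [lossD, loss]
  rw [deriv_comp_mul_left y φ v, smul_eq_mul]

lemma lossD2_eq (y v : ℝ) : lossD2 φ y v = y ^ 2 * deriv (deriv φ) (y * v) := by
  simp only [lossD2, lossD_eq]
  rw [deriv_const_mul_field, deriv_comp_mul_left y (deriv φ) v, smul_eq_mul]
  ring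

/-- A positive second derivative at all risk minimizers with class probability in `[δ, 1 - δ]`
remains positive on a neighbourhood of uniform radius of these minimizers. -/
lemma IsArchLoss.exists_radius (hφ : IsArchLoss φ) (hφ2 : Continuous (deriv (deriv φ)))
    {δ : ℝ} (hδ0 : 0 < δ)
    (hconv : ∀ p ∈ Set.Icc δ (1 - δ), ∀ v : ℝ, IsPointwiseMin φ p v →
      0 < p * lossD2 φ 1 v + (1 - p) * lossD2 φ (-1) v) :
    ∃ r > 0, ∀ p ∈ Set.Icc δ (1 - δ), ∀ v₀, IsPointwiseMin φ p v₀ → ∀ v, |v - v₀| < r →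
      0 < p * lossD2 φ 1 v + (1 - p) * lossD2 φ (-1) v := by
  have hex : ∀ p, ∃ v, p ∈ Set.Icc δ (1 - δ) → IsPointwiseMin φ p v := fun p => by
    by_cases hp : p ∈ Set.Icc δ (1 - δ)
    · obtain ⟨v, -, -, hv⟩ := hφ.unique_critical p (hδ0.trans_le hp.1) (by linarith [hp.2])
      exact ⟨v, fun _ => isPointwiseMin_iff.2 hv⟩
    · exact ⟨0, fun h => absurd h hp⟩
  choose s hs using hex
  have hcont := hφ.continuousOn_minimizer hδ0 hs
  have hK : IsCompact ((fun p => (p, s p)) '' Set.Icc δ (1 - δ)) :=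
    isCompact_Icc.image_of_continuousOn (continuousOn_id.prodMk hcont)
  have hU : IsOpen {x : ℝ × ℝ | 0 < x.1 * lossD2 φ 1 x.2 + (1 - x.1) * lossD2 φ (-1) x.2} := by
    simp only [lossD2_eq]
    exact isOpen_lt continuous_const (by fun_prop)
  obtain ⟨r, hr, hsub⟩ := hK.exists_thickening_subset_open hU (by
    rintro _ ⟨p, hp, rfl⟩
    exact hconv p hp _ (hs p hp))
  refine ⟨r, hr, fun p hp v₀ hv₀ v hv => ?_⟩
  have hv₀s : v₀ = s p := by
    refine hφ.critical_of_isPointwiseMin (hδ0.trans_le hp.1) (by linarith [hp.2]) (hs p hp) v₀ ?_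
    exact IsLocalMin.deriv_eq_zero (Eventually.of_forall (isPointwiseMin_iff.1 hv₀))
  refine hsub (a := (p, v)) (Metric.mem_thickening_iff.2 ⟨(p, s p), ⟨p, hp, rfl⟩, ?_⟩)
  rw [Prod.dist_eq, dist_self, Real.dist_eq, ← hv₀s]
  exact max_lt hr hv

lemma exists_abs_le_of_continuous {ψ : ℝ → ℝ} (hψ : Continuous ψ) (K : ℝ) :
    ∃ C, 0 ≤ C ∧ ∀ v, |v| ≤ K → |ψ v| ≤ C := by
  obtain ⟨C, hC⟩ := (isCompact_Icc (a := -K) (b := K)).exists_bound_of_continuousOn hψ.continuousOn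
  exact ⟨max C 0, le_max_right _ _, fun v hv => (hC v (abs_le.1 hv)).trans (le_max_left _ _)⟩

/-- First-order Taylor expansion of a `C¹` function, uniformly on bounded sets. -/
lemma exists_taylor_bound {β : ℝ → ℝ} (hβ : Differentiable ℝ β) (hβ' : Continuous (deriv β))
    (K : ℝ) {c : ℝ} (hc : 0 < c) :
    ∃ s > 0, ∀ v u, |v| ≤ K → |u| < s → |β (v + u) - β v - deriv β v * u| ≤ c * |u| := by
  have huc : UniformContinuousOn (deriv β) (Set.Icc (-(K + 1)) (K + 1)) :=
    isCompact_Icc.uniformContinuousOn_of_continuous hβ'.continuousOn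
  obtain ⟨s, hs, hsc⟩ := Metric.uniformContinuousOn_iff_le.1 huc c hc
  refine ⟨min s 1, by positivity, fun v u hv hu => ?_⟩
  have hus := hu.trans_le (min_le_left _ _)
  have hu1 := hu.trans_le (min_le_right _ _)
  have hball : ∀ x ∈ Metric.closedBall v |u|, ‖deriv (fun x => β x - deriv β v * x) x‖ ≤ c := by
    intro x hx
    have hd : deriv (fun x => β x - deriv β v * x) x = deriv β x - deriv β v := by
      have := (hβ x).hasDerivAt.sub ((hasDerivAt_id x).const_mul (deriv β v))
      simpa using! this.deriv
    rw [hd, ← dist_eq_norm]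
    rw [Metric.mem_closedBall] at hx
    have hx' := hx
    rw [Real.dist_eq, abs_le] at hx'
    have h1 := abs_le.1 hv
    refine hsc x ⟨?_, ?_⟩ v ⟨?_, ?_⟩ (hx.trans hus.le) <;> linarith [hx'.1, hx'.2, h1.1, h1.2]
  have := (convex_closedBall v |u|).norm_image_sub_le_of_norm_deriv_le
    (f := fun x => β x - deriv β v * x) (x := v) (y := v + u)
    (fun x _ => by fun_prop) hball (Metric.mem_closedBall_self (abs_nonneg _))
    (by simp)
  simp only [Real.norm_eq_abs, add_sub_cancel_left] at this
  convert this using 2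
  ring

end Loss

/-! ### The loss composed with predictions, and its integrals -/

lemma label_sq (y : Label) : (y : ℝ) ^ 2 = 1 := by
  rcases y.2 with h | h
  · simp [h]
  · rw [Set.mem_singleton_iff.1 h, one_pow]

lemma abs_label (y : Label) : |(y : ℝ)| = 1 := by
  rw [← sq_eq_sq₀ (abs_nonneg _) zero_le_one, sq_abs, label_sq, one_pow]

lemma abs_lossD (φ : ℝ → ℝ) (y : Label) (v : ℝ) : |lossD φ y v| = |deriv φ (y * v)| := by
  rw [lossD_eq, abs_mul, abs_label, one_mul]

lemma exists_loss_bound {φ : ℝ → ℝ} (hφ2 : ContDiff ℝ 2 φ) (K : ℝ) :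
    ∃ C, 0 ≤ C ∧ ∀ (y : Label) (v : ℝ), |v| ≤ K →
      |loss φ y v| ≤ C ∧ |lossD φ y v| ≤ C ∧ |lossD2 φ y v| ≤ C := by
  have h1 : Continuous (deriv φ) := hφ2.continuous_deriv (by norm_num)
  have h2 : Continuous (deriv (deriv φ)) := by
    have : ContDiff ℝ 1 (deriv φ) := ContDiff.deriv' hφ2
    exact this.continuous_deriv le_rfl
  obtain ⟨A, hA0, hA⟩ := exists_abs_le_of_continuous hφ2.continuous K
  obtain ⟨B, hB0, hB⟩ := exists_abs_le_of_continuous h1 K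
  obtain ⟨C, hC0, hC⟩ := exists_abs_le_of_continuous h2 K
  refine ⟨A + B + C, by positivity, fun y v hv => ?_⟩
  have hyv : |(y : ℝ) * v| ≤ K := by rwa [abs_mul, abs_label, one_mul]
  refine ⟨?_, ?_, ?_⟩
  · rw [loss]; linarith [hA _ hyv]
  · rw [abs_lossD]; linarith [hB _ hyv]
  · rw [lossD2_eq, label_sq, one_mul]; linarith [hC _ hyv]

section

variable {𝒳 : Type*} [MeasurableSpace 𝒳]

lemma measurable_loss {φ : ℝ → ℝ} (hφ2 : ContDiff ℝ 2 φ) {u : 𝒳 → ℝ} (hu : Measurable u) :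
    Measurable (fun w : 𝒳 × Label => loss φ w.2 (u w.1)) ∧
    Measurable (fun w : 𝒳 × Label => lossD φ w.2 (u w.1)) ∧
    Measurable (fun w : 𝒳 × Label => lossD2 φ w.2 (u w.1)) := by
  have h0 := hφ2.continuous.measurable
  have h1 := measurable_deriv φ
  have h2 := measurable_deriv (deriv φ)
  have hyu : Measurable (fun w : 𝒳 × Label => (w.2 : ℝ) * u w.1) := by fun_prop
  refine ⟨h0.comp hyu, ?_, ?_⟩
  · simp only [lossD_eq]
    exact (by fun_prop : Measurable (fun w : 𝒳 × Label => (w.2 : ℝ))).mul (h1.comp hyu)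
  · simp only [lossD2_eq, label_sq, one_mul]
    exact h2.comp hyu

lemma isProbabilityMeasure_contaminate (P : Measure (𝒳 × Label)) [IsProbabilityMeasure P]
    (z : 𝒳 × Label) {ε : ℝ} (h0 : 0 ≤ ε) (h1 : ε ≤ 1) :
    IsProbabilityMeasure (contaminate P z ε) := by
  constructor
  simp only [contaminate, Measure.add_apply, Measure.smul_apply, measure_univ, smul_eq_mul,
    mul_one]
  rw [← ENNReal.ofReal_add (by linarith) h0]
  simp

lemma integral_contaminate (P : Measure (𝒳 × Label)) [IsProbabilityMeasure P]
    (z : 𝒳 × Label) {ε : ℝ} (h0 : 0 ≤ ε) (h1 : ε ≤ 1) {F : 𝒳 × Label → ℝ} (hF : Measurable F)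
    {C : ℝ} (hC : ∀ w, |F w| ≤ C) :
    ∫ w, F w ∂(contaminate P z ε) = (1 - ε) * ∫ w, F w ∂P + ε * F z := by
  have hint : ∀ (Q : Measure (𝒳 × Label)) [IsFiniteMeasure Q], Integrable F Q := fun Q _ =>
    Integrable.of_bound hF.aestronglyMeasurable C (Eventually.of_forall hC)
  rw [contaminate, integral_add_measure ((hint P).smul_measure ENNReal.ofReal_ne_top)
    ((hint _).smul_measure ENNReal.ofReal_ne_top), integral_smul_measure, integral_smul_measure,
    integral_dirac' _ _ hF.stronglyMeasurable, ENNReal.toReal_ofReal (by linarith),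
    ENNReal.toReal_ofReal h0, smul_eq_mul, smul_eq_mul]

lemma measurableSet_label_eq_one : MeasurableSet {w : 𝒳 × Label | (w.2 : ℝ) = 1} :=
  measurableSet_eq_fun (measurable_subtype_coe.comp measurable_snd) measurable_const

/-- The defining property of the conditional class probability, for test functions of `X`. -/
lemma IsClassProb.integral_mul_indicator {P : Measure (𝒳 × Label)} [IsProbabilityMeasure P]
    {η : 𝒳 → ℝ} (hη : IsClassProb P η) {a : 𝒳 → ℝ} (ha : Measurable a) {C : ℝ}
    (hC : ∀ x, |a x| ≤ C) :
    ∫ w : 𝒳 × Label, a w.1 * {w : 𝒳 × Label | (w.2 : ℝ) = 1}.indicator (fun _ => (1 : ℝ)) w ∂P =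
      ∫ w, a w.1 * η w.1 ∂P := by
  set s : Set (𝒳 × Label) := {w | (w.2 : ℝ) = 1}
  have ham : StronglyMeasurable[MeasurableSpace.comap Prod.fst inferInstance]
      (fun w : 𝒳 × Label => a w.1) :=
    (ha.comp (comap_measurable Prod.fst)).stronglyMeasurable
  have hsi : Integrable (s.indicator (fun _ => (1 : ℝ))) P :=
    (integrable_const 1).indicator measurableSet_label_eq_one
  have hai : Integrable ((fun w : 𝒳 × Label => a w.1) * s.indicator (fun _ => (1 : ℝ))) P :=
    hsi.bdd_mul (ha.comp measurable_fst).aestronglyMeasurable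
      (Eventually.of_forall fun w => hC w.1)
  have hpull := condExp_mul_of_stronglyMeasurable_left ham hai hsi
  have h1 := integral_condExp (μ := P) (measurable_fst (α := 𝒳) (β := Label)).comap_le
    (f := (fun w : 𝒳 × Label => a w.1) * s.indicator (fun _ => (1 : ℝ)))
  calc _ = _ := h1.symm
    _ = _ := integral_congr_ae ?_
  filter_upwards [hpull, hη.2] with w hw hw2
  rw [hw, Pi.mul_apply, hw2]

/-- If the conditional expectation of `φ''(Y, u(X))` given `X` is nonnegative, then so is its
expectation against any nonnegative weight that depends on `X` only. -/
lemma IsClassProb.integral_lossD2_nonneg {P : Measure (𝒳 × Label)} [IsProbabilityMeasure P]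
    {η : 𝒳 → ℝ} (hη : IsClassProb P η) {φ : ℝ → ℝ} (hφ2 : ContDiff ℝ 2 φ)
    {u b : 𝒳 → ℝ} (hu : Measurable u) (hb : Measurable b) {K B : ℝ}
    (hK : ∀ x, |u x| ≤ K) (hB : ∀ x, |b x| ≤ B) (hb0 : ∀ x, 0 ≤ b x)
    (hpos : ∀ᵐ x ∂(P.map Prod.fst),
      0 ≤ η x * lossD2 φ 1 (u x) + (1 - η x) * lossD2 φ (-1) (u x)) :
    0 ≤ ∫ w, lossD2 φ w.2 (u w.1) * b w.1 ∂P := by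
  obtain ⟨C, hC0, hC⟩ := exists_loss_bound hφ2 K
  have hγ := measurable_deriv (deriv φ)
  have m1 : Measurable (fun x => lossD2 φ 1 (u x)) := by
    simp only [lossD2_eq, one_pow, one_mul]; exact hγ.comp hu
  have m2 : Measurable (fun x => lossD2 φ (-1) (u x)) := by
    simp only [lossD2_eq, neg_one_sq, one_mul, neg_mul]; exact hγ.comp hu.neg
  have c1 : ∀ x, |lossD2 φ 1 (u x)| ≤ C := fun x => (hC ⟨1, by simp⟩ _ (hK x)).2.2
  have c2 : ∀ x, |lossD2 φ (-1) (u x)| ≤ C := fun x => (hC ⟨-1, by simp⟩ _ (hK x)).2.2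
  have hbound : ∀ {x : ℝ} {y : ℝ}, |x| ≤ C → |y| ≤ B → |x * y| ≤ C * B := fun hx hy => by
    rw [abs_mul]; exact mul_le_mul hx hy (abs_nonneg _) hC0
  set a : 𝒳 → ℝ := fun x => (lossD2 φ 1 (u x) - lossD2 φ (-1) (u x)) * b x with hadef
  have ha : Measurable a := (m1.sub m2).mul hb
  have haC : ∀ x, |a x| ≤ C * B + C * B := fun x => by
    simp only [hadef, sub_mul]
    exact (abs_sub _ _).trans (add_le_add (hbound (c1 x) (hB x)) (hbound (c2 x) (hB x)))
  have hi2 : Integrable (fun w : 𝒳 × Label => lossD2 φ (-1) (u w.1) * b w.1) P :=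
    Integrable.of_bound ((m2.mul hb).comp measurable_fst).aestronglyMeasurable (C * B)
      (Eventually.of_forall fun w => hbound (c2 w.1) (hB w.1))
  have hi1 : Integrable (fun w : 𝒳 × Label =>
      a w.1 * {w : 𝒳 × Label | (w.2 : ℝ) = 1}.indicator (fun _ => (1 : ℝ)) w) P :=
    ((integrable_const 1).indicator measurableSet_label_eq_one).bdd_mul (ha.comp measurable_fst).aestronglyMeasurable
      (Eventually.of_forall fun w => haC w.1)
  have hηi : Integrable (fun w : 𝒳 × Label => η w.1) P :=
    integrable_condExp.congr hη.2.symm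
  have hi3 : Integrable (fun w : 𝒳 × Label => a w.1 * η w.1) P :=
    hηi.bdd_mul (ha.comp measurable_fst).aestronglyMeasurable
      (Eventually.of_forall fun w => haC w.1)
  have hsplit : ∀ w : 𝒳 × Label, lossD2 φ w.2 (u w.1) * b w.1 =
      a w.1 * {w : 𝒳 × Label | (w.2 : ℝ) = 1}.indicator (fun _ => (1 : ℝ)) w +
        lossD2 φ (-1) (u w.1) * b w.1 := by
    intro w
    rcases w.2.2 with h | h
    · simp only [Set.indicator, Set.mem_ofPred_eq, h]
      norm_num
    · simp only [Set.indicator, Set.mem_ofPred_eq, Set.mem_singleton_iff.1 h, hadef]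
      simp only [if_true]
      ring
  calc 0 ≤ ∫ w : 𝒳 × Label, (a w.1 * η w.1 + lossD2 φ (-1) (u w.1) * b w.1) ∂P := by
        refine integral_nonneg_of_ae ?_
        filter_upwards [ae_of_ae_map measurable_fst.aemeasurable hpos] with w hw
        simp only [Pi.zero_apply, hadef]
        have := mul_nonneg hw (hb0 w.1)
        linarith
    _ = _ := by
        rw [integral_add hi3 hi2, ← hη.integral_mul_indicator ha haC, ← integral_add hi1 hi2]
        exact integral_congr_ae (Eventually.of_forall fun w => (hsplit w).symm)

end

/-! ### Weak sequential compactness in Hilbert spaces -/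

/-- Bounded sequences in a Hilbert space, separable or not, have weakly convergent subsequences:
the sequential Banach–Alaoglu theorem applies in the closed span of the sequence. -/
lemma exists_subseq_weak_tendsto {H : Type*} [NormedAddCommGroup H] [InnerProductSpace ℝ H]
    [CompleteSpace H] {u : ℕ → H} {ρ : ℝ} (hu : ∀ n, ‖u n‖ ≤ ρ) :
    ∃ (f : H) (ψ : ℕ → ℕ), StrictMono ψ ∧
      ∀ h, Tendsto (fun n => inner ℝ (u (ψ n)) h) atTop (𝓝 (inner ℝ f h)) := by
  let V : Submodule ℝ H := (Submodule.span ℝ (Set.range u)).topologicalClosure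
  have hV : ∀ n, u n ∈ V := fun n =>
    Submodule.le_topologicalClosure _ (Submodule.subset_span ⟨n, rfl⟩)
  have : CompleteSpace V := (Submodule.isClosed_topologicalClosure _).completeSpace_coe
  have : TopologicalSpace.SeparableSpace V := by
    have : TopologicalSpace.IsSeparable (V : Set H) :=
      ((Set.countable_range u).isSeparable.span (R := ℝ)).closure
    exact this.separableSpace
  let v : ℕ → V := fun n => ⟨u n, hV n⟩
  let d : ℕ → WeakDual ℝ V := fun n =>
    StrongDual.toWeakDual (InnerProductSpace.toDual ℝ V (v n))
  have hd : ∀ n, d n ∈ WeakDual.toStrongDual ⁻¹' Metric.closedBall (0 : StrongDual ℝ V) ρ := by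
    intro n
    refine (mem_closedBall_zero_iff (E := StrongDual ℝ V)).2 ?_
    exact (LinearIsometryEquiv.norm_map (InnerProductSpace.toDual ℝ V) (v n)).trans_le (hu n)
  obtain ⟨ℓ, -, ψ, hψ, hlim⟩ := WeakDual.isSeqCompact_closedBall ℝ V 0 ρ hd
  refine ⟨((InnerProductSpace.toDual ℝ V).symm (WeakDual.toStrongDual ℓ) : V), ψ, hψ, fun h => ?_⟩
  have h1 := ((WeakDual.eval_continuous (V.orthogonalProjectionOnto h)).tendsto ℓ).comp hlim
  have h2 : ∀ x : V, inner ℝ (x : H) h = inner ℝ x (V.orthogonalProjectionOnto h) := fun x => by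
    rw [← Submodule.inner_orthogonalProjectionOnto_eq_of_mem_left]
  rw [h2, InnerProductSpace.toDual_symm_apply]
  refine h1.congr fun n => ?_
  exact (h2 (v (ψ n))).symm

/-! ### Regularized risk minimizers -/

section

variable {𝒳 : Type*} [MeasurableSpace 𝒳] {H : Type*} [NormedAddCommGroup H]
  [InnerProductSpace ℝ H] [RKHS ℝ H 𝒳 ℝ]

lemma integrable_of_measurable_of_abs_le {Ω : Type*} [MeasurableSpace Ω] {F : Ω → ℝ}
    (hF : Measurable F) {C : ℝ} (hC : ∀ w, |F w| ≤ C) (Q : Measure Ω) [IsFiniteMeasure Q] :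
    Integrable F Q :=
  Integrable.of_bound hF.aestronglyMeasurable C (Eventually.of_forall hC)

lemma abs_integral_le_of_abs_le {Ω : Type*} [MeasurableSpace Ω] {F : Ω → ℝ} {C : ℝ}
    (hC : ∀ w, |F w| ≤ C) (Q : Measure Ω) [IsProbabilityMeasure Q] : |∫ w, F w ∂Q| ≤ C := by
  simpa using norm_integral_le_of_norm_le_const (μ := Q) (f := F) (Eventually.of_forall hC)

lemma norm_le_of_isRegMinimizer {φ : ℝ → ℝ} (hφ : ∀ v, 0 ≤ φ v) {lam : ℝ} (hlam : 0 < lam)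
    {Q : Measure (𝒳 × Label)} [IsProbabilityMeasure Q] {f : H} (hf : IsRegMinimizer φ lam Q f) :
    ‖f‖ ≤ √(loss φ 0 0 / lam) := by
  have h0 := hf 0
  have h1 : 0 ≤ ∫ w, loss φ w.2 (f w.1) ∂Q := integral_nonneg fun w => hφ _
  simp only [regRisk, RKHS.coe_zero, Pi.zero_apply, loss, mul_zero, integral_const,
    probReal_univ, norm_zero] at h0
  simp only [loss] at h1
  refine Real.le_sqrt_of_sq_le ?_
  rw [le_div_iff₀ hlam, loss, mul_zero]
  simp at h0
  linarith

/-- The Euler–Lagrange equation of the regularized risk. -/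
lemma IsRegMinimizer.euler_lagrange {φ : ℝ → ℝ} (hφ2 : ContDiff ℝ 2 φ)
    (hH : ∀ f : H, Measurable (fun x => f x)) {κ : ℝ}
    (hκ : ∀ (f : H) (x : 𝒳), |f x| ≤ κ * ‖f‖) {lam : ℝ}
    {Q : Measure (𝒳 × Label)} [IsProbabilityMeasure Q] {f : H} (hf : IsRegMinimizer φ lam Q f)
    (h : H) :
    ∫ w, lossD φ w.2 (f w.1) * h w.1 ∂Q + 2 * lam * inner ℝ f h = 0 := by
  obtain ⟨C, hC0, hC⟩ := exists_loss_bound hφ2 (κ * (‖f‖ + ‖h‖))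
  have hbd : ∀ t ∈ Metric.ball (0 : ℝ) 1, ∀ x, |f x + t * h x| ≤ κ * (‖f‖ + ‖h‖) := by
    intro t ht x
    have ht' : |t| ≤ 1 := by simpa using (Metric.mem_ball.1 ht).le
    calc |f x + t * h x| ≤ |f x| + |t| * |h x| := by rw [← abs_mul]; exact abs_add_le _ _
      _ ≤ κ * ‖f‖ + 1 * (κ * ‖h‖) := by gcongr <;> exact hκ _ _
      _ = _ := by ring
  have hmeas : ∀ t : ℝ, Measurable (fun x => f x + t * h x) := fun t =>
    (hH f).add ((hH h).const_mul t)
  have hφd : Differentiable ℝ φ := hφ2.differentiable (by norm_num)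
  have hderiv := (hasDerivAt_integral_of_dominated_loc_of_deriv_le (μ := Q)
    (F := fun (t : ℝ) (w : 𝒳 × Label) => loss φ w.2 (f w.1 + t * h w.1))
    (F' := fun (t : ℝ) (w : 𝒳 × Label) => lossD φ w.2 (f w.1 + t * h w.1) * h w.1)
    (x₀ := (0 : ℝ)) (bound := fun _ => C * (κ * ‖h‖)) (Metric.ball_mem_nhds 0 one_pos)
    (Eventually.of_forall fun t => (measurable_loss hφ2 (hmeas t)).1.aestronglyMeasurable)
    (integrable_of_measurable_of_abs_le (measurable_loss hφ2 (hmeas 0)).1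
      (fun w => (hC w.2 _ (hbd 0 (by simp) w.1)).1) Q)
    (((measurable_loss hφ2 (hmeas 0)).2.1.mul
      ((hH h).comp measurable_fst)).aestronglyMeasurable)
    (Eventually.of_forall fun w t ht => by
      rw [Real.norm_eq_abs, abs_mul]
      exact mul_le_mul (hC w.2 _ (hbd t ht w.1)).2.1 (hκ _ _) (abs_nonneg _) hC0)
    (integrable_const _)
    (Eventually.of_forall fun w t _ => by
      have h1 : HasDerivAt (fun t : ℝ => (w.2 : ℝ) * (f w.1 + t * h w.1)) (w.2 * h w.1) t := by
        simpa using! ((hasDerivAt_id t).mul_const (h w.1)).const_add (f w.1) |>.const_mul (w.2 : ℝ)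
      have h2 := (hφd ((w.2 : ℝ) * (f w.1 + t * h w.1))).hasDerivAt.comp t h1
      rw [lossD_eq]
      exact h2.congr_deriv (by ring))).2
  have hnorm : HasDerivAt (fun t : ℝ => lam * ‖f + t • h‖ ^ 2) (2 * lam * inner ℝ f h) 0 := by
    have e : (fun t : ℝ => lam * ‖f + t • h‖ ^ 2) =
        fun t => lam * (‖f‖ ^ 2 + 2 * (t * inner ℝ f h) + t ^ 2 * ‖h‖ ^ 2) := by
      funext t
      rw [norm_add_sq_real, inner_smul_right, norm_smul, mul_pow, Real.norm_eq_abs, sq_abs]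
    rw [e]
    have := ((((hasDerivAt_id (0 : ℝ)).mul_const (inner ℝ f h)).const_mul 2).const_add
      (‖f‖ ^ 2)).add ((hasDerivAt_pow 2 (0 : ℝ)).mul_const (‖h‖ ^ 2)) |>.const_mul lam
    exact this.congr_deriv (by simp; ring)
  have hmin : IsLocalMin (fun t : ℝ => ∫ w, loss φ w.2 (f w.1 + t * h w.1) ∂Q +
      lam * ‖f + t • h‖ ^ 2) 0 := by
    refine Eventually.of_forall fun t => ?_
    simpa [regRisk] using hf (f + t • h)
  simpa using hmin.hasDerivAt_eq_zero (hderiv.add hnorm)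

variable [CompleteSpace H]

/-- The risk is sequentially continuous for the weak topology on bounded subsets. -/
lemma tendsto_risk_of_weak_tendsto {φ : ℝ → ℝ} (hφ2 : ContDiff ℝ 2 φ)
    (hH : ∀ f : H, Measurable (fun x => f x)) {κ : ℝ} (hκ0 : 0 ≤ κ)
    (hκ : ∀ (f : H) (x : 𝒳), |f x| ≤ κ * ‖f‖)
    (P : Measure (𝒳 × Label)) [IsProbabilityMeasure P] {u : ℕ → H} {ρ : ℝ}
    (hu : ∀ n, ‖u n‖ ≤ ρ) {f : H}
    (hlim : ∀ h, Tendsto (fun n => inner ℝ (u n) h) atTop (𝓝 (inner ℝ f h))) :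
    Tendsto (fun n => ∫ w, loss φ w.2 (u n w.1) ∂P) atTop
      (𝓝 (∫ w, loss φ w.2 (f w.1) ∂P)) := by
  obtain ⟨C, -, hC⟩ := exists_loss_bound hφ2 (κ * ρ)
  refine tendsto_integral_of_dominated_convergence (fun _ => C)
    (fun n => (measurable_loss hφ2 (hH (u n))).1.aestronglyMeasurable) (integrable_const _)
    (fun n => Eventually.of_forall fun w => (hC w.2 _ ?_).1) (Eventually.of_forall fun w => ?_)
  · exact (hκ _ _).trans (mul_le_mul_of_nonneg_left (hu n) hκ0)
  · have h1 : Tendsto (fun n => u n w.1) atTop (𝓝 (f w.1)) := by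
      simpa using hlim (RKHS.kerFun H w.1 1)
    exact (hφ2.continuous.tendsto _).comp (h1.const_mul _)

/-- Minimizers of the contaminated problems converge in norm to the unique minimizer of the
uncontaminated one. -/
lemma tendsto_minimizer {φ : ℝ → ℝ} (hφ : ∀ v, 0 ≤ φ v) (hφ2 : ContDiff ℝ 2 φ)
    (hH : ∀ f : H, Measurable (fun x => f x)) {κ : ℝ} (hκ0 : 0 ≤ κ)
    (hκ : ∀ (f : H) (x : 𝒳), |f x| ≤ κ * ‖f‖) {lam : ℝ} (hlam : 0 < lam)
    (P : Measure (𝒳 × Label)) [IsProbabilityMeasure P] {T : Measure (𝒳 × Label) → H}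
    (hT : ∀ Q : Measure (𝒳 × Label), IsProbabilityMeasure Q → IsRegMinimizer φ lam Q (T Q))
    (hTP : ∀ f : H, IsRegMinimizer φ lam P f → f = T P) (z : 𝒳 × Label) :
    Tendsto (fun ε => T (contaminate P z ε)) (𝓝[>] 0) (𝓝 (T P)) := by
  set ρ := √(loss φ 0 0 / lam) with hρ
  obtain ⟨C, hC0, hC⟩ := exists_loss_bound hφ2 (κ * ρ)
  have hsup : ∀ f : H, ‖f‖ ≤ ρ → ∀ w : 𝒳 × Label, |loss φ w.2 (f w.1)| ≤ C := fun f hf w =>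
    (hC w.2 _ ((hκ _ _).trans (mul_le_mul_of_nonneg_left hf hκ0))).1
  -- on the ball of radius `ρ`, the risks under `P` and its contamination differ by at most `2 ε C`
  have hclose : ∀ ε : ℝ, 0 ≤ ε → ε ≤ 1 → ∀ f : H, ‖f‖ ≤ ρ →
      |regRisk φ lam (contaminate P z ε) f - regRisk φ lam P f| ≤ 2 * (ε * C) := by
    intro ε h0 h1 f hf
    rw [regRisk, regRisk, integral_contaminate P z h0 h1 (measurable_loss hφ2 (hH f)).1 (hsup f hf)]
    have e1 := abs_integral_le_of_abs_le (hsup f hf) P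
    have e2 := hsup f hf z
    rw [abs_le] at *
    constructor <;> nlinarith [e1.1, e1.2, e2.1, e2.2]
  have hnP : ‖T P‖ ≤ ρ := norm_le_of_isRegMinimizer hφ hlam (hT P inferInstance)
  refine tendsto_of_subseq_tendsto fun x hx => ?_
  -- clipping the contamination level makes every term of the sequence a probability measure
  set y : ℕ → ℝ := fun n => max 0 (min 1 (x n)) with hy
  have hy0 : ∀ n, 0 ≤ y n := fun n => le_max_left _ _
  have hy1 : ∀ n, y n ≤ 1 := fun n => max_le zero_le_one (min_le_left _ _)
  have hx0 : Tendsto x atTop (𝓝 0) := tendsto_nhds_of_tendsto_nhdsWithin hx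
  have hxy : ∀ᶠ n in atTop, y n = x n := by
    filter_upwards [hx.eventually self_mem_nhdsWithin,
      hx0.eventually (gt_mem_nhds one_pos)] with n hn1 hn2
    simp only [hy]
    rw [min_eq_right hn2.le, max_eq_right (le_of_lt hn1)]
  have hylim : Tendsto y atTop (𝓝 0) := hx0.congr' (hxy.mono fun n hn => hn.symm)
  set u : ℕ → H := fun n => T (contaminate P z (y n)) with hu
  have hprob : ∀ n, IsProbabilityMeasure (contaminate P z (y n)) := fun n =>
    isProbabilityMeasure_contaminate P z (hy0 n) (hy1 n)
  have hun : ∀ n, ‖u n‖ ≤ ρ := fun n => by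
    have := hprob n
    exact norm_le_of_isRegMinimizer hφ hlam (hT _ this)
  have hrisk : ∀ n, regRisk φ lam P (u n) ≤ regRisk φ lam P (T P) + 4 * (y n * C) := fun n => by
    have h1 := abs_le.1 (hclose (y n) (hy0 n) (hy1 n) (u n) (hun n))
    have h2 := abs_le.1 (hclose (y n) (hy0 n) (hy1 n) (T P) hnP)
    have h3 := hT _ (hprob n) (T P)
    simp only [hu] at *
    linarith [h1.1, h2.2]
  obtain ⟨f, ψ, hψ, hweak⟩ := exists_subseq_weak_tendsto hun
  refine ⟨ψ, ?_⟩
  have hRlim := tendsto_risk_of_weak_tendsto hφ2 hH hκ0 hκ P (fun n => hun (ψ n)) hweak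
  have hyψ : Tendsto (fun n => 4 * (y (ψ n) * C)) atTop (𝓝 0) := by
    simpa using ((hylim.comp hψ.tendsto_atTop).mul_const C).const_mul 4
  -- the weak limit is a minimizer, as the norm is weakly lower semicontinuous
  have hf : f = T P := by
    refine hTP f fun g => le_trans ?_ (hT P inferInstance g)
    have hl : Tendsto (fun n => ∫ w, loss φ w.2 (u (ψ n) w.1) ∂P +
        lam * (2 * inner ℝ (u (ψ n)) f - ‖f‖ ^ 2)) atTop
        (𝓝 (∫ w, loss φ w.2 (f w.1) ∂P + lam * (2 * inner ℝ f f - ‖f‖ ^ 2))) :=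
      hRlim.add ((((hweak f).const_mul 2).sub_const _).const_mul lam)
    have hr : Tendsto (fun n => regRisk φ lam P (T P) + 4 * (y (ψ n) * C)) atTop
        (𝓝 (regRisk φ lam P (T P) + 0)) := hyψ.const_add _
    have := le_of_tendsto_of_tendsto' hl hr fun n => by
      refine le_trans ?_ (hrisk (ψ n))
      rw [regRisk]
      have := norm_sub_sq_real (u (ψ n)) f
      nlinarith [sq_nonneg ‖u (ψ n) - f‖]
    rw [real_inner_self_eq_norm_sq, add_zero] at this
    rw [regRisk]
    linarith
  subst hf
  have hsq : Tendsto (fun n => ‖u (ψ n) - T P‖ ^ 2) atTop (𝓝 0) := by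
    have hub : Tendsto (fun n => lam⁻¹ * (regRisk φ lam P (T P) + 4 * (y (ψ n) * C) -
        ∫ w, loss φ w.2 (u (ψ n) w.1) ∂P) - 2 * inner ℝ (u (ψ n)) (T P) + ‖T P‖ ^ 2) atTop
        (𝓝 (lam⁻¹ * (regRisk φ lam P (T P) + 0 - ∫ w, loss φ w.2 (T P w.1) ∂P) -
          2 * inner ℝ (T P) (T P) + ‖T P‖ ^ 2)) :=
      ((((hyψ.const_add _).sub hRlim).const_mul _).sub ((hweak (T P)).const_mul 2)).add_const _
    have h0 : lam⁻¹ * (regRisk φ lam P (T P) + 0 - ∫ w, loss φ w.2 (T P w.1) ∂P) -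
          2 * inner ℝ (T P) (T P) + ‖T P‖ ^ 2 = 0 := by
      rw [regRisk, real_inner_self_eq_norm_sq]
      field_simp
      ring
    rw [h0] at hub
    refine squeeze_zero (fun n => sq_nonneg _) (fun n => ?_) hub
    rw [norm_sub_sq_real]
    have h3 := hrisk (ψ n)
    rw [regRisk] at h3
    have h4 : ‖u (ψ n)‖ ^ 2 ≤ lam⁻¹ * (regRisk φ lam P (T P) + 4 * (y (ψ n) * C) -
        ∫ w, loss φ w.2 (u (ψ n) w.1) ∂P) := by
      rw [inv_mul_eq_div, le_div_iff₀ hlam]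
      linarith
    linarith
  have hlim : Tendsto (fun n => u (ψ n)) atTop (𝓝 (T P)) := by
    rw [tendsto_iff_norm_sub_tendsto_zero]
    simpa using hsq.sqrt
  refine hlim.congr' ?_
  filter_upwards [hψ.tendsto_atTop.eventually hxy] with n hn
  simp only [hu]
  rw [hn]

end

/-! ### The influence equation -/

lemma abs_mul_le_mul {a b C D : ℝ} (ha : |a| ≤ C) (hb : |b| ≤ D) : |a * b| ≤ C * D := by
  rw [abs_mul]
  exact mul_le_mul ha hb (abs_nonneg _) ((abs_nonneg _).trans ha)

section

variable {𝒳 : Type*} [MeasurableSpace 𝒳] {H : Type*} [NormedAddCommGroup H]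
  [InnerProductSpace ℝ H] [RKHS ℝ H 𝒳 ℝ]

/-- The bilinear form `⟨S u, h⟩` of the operator `S` of the influence equation;
it is the second derivative of the regularized risk at `f`. -/
noncomputable def hessianForm (φ : ℝ → ℝ) (lam : ℝ) (P : Measure (𝒳 × Label)) (f u h : H) : ℝ :=
  (∫ w, lossD2 φ w.2 (f w.1) * u w.1 * h w.1 ∂P) + 2 * lam * inner ℝ u h

lemma integrable_hessian {φ : ℝ → ℝ} (hφ2 : ContDiff ℝ 2 φ)
    (hH : ∀ f : H, Measurable (fun x => f x)) {κ : ℝ}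
    (hκ : ∀ (f : H) (x : 𝒳), |f x| ≤ κ * ‖f‖)
    (P : Measure (𝒳 × Label)) [IsProbabilityMeasure P] (f u h : H) :
    Integrable (fun w => lossD2 φ w.2 (f w.1) * u w.1 * h w.1) P := by
  obtain ⟨C, -, hC⟩ := exists_loss_bound hφ2 (κ * ‖f‖)
  exact integrable_of_measurable_of_abs_le
    (((measurable_loss hφ2 (hH f)).2.2.mul ((hH u).comp measurable_fst)).mul
      ((hH h).comp measurable_fst))
    (fun w => abs_mul_le_mul (abs_mul_le_mul (hC w.2 _ (hκ f w.1)).2.2 (hκ u w.1))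
      (hκ h w.1)) P

lemma integrable_lossD {φ : ℝ → ℝ} (hφ2 : ContDiff ℝ 2 φ)
    (hH : ∀ f : H, Measurable (fun x => f x)) {κ : ℝ}
    (hκ : ∀ (f : H) (x : 𝒳), |f x| ≤ κ * ‖f‖)
    (P : Measure (𝒳 × Label)) [IsProbabilityMeasure P] (f h : H) :
    Integrable (fun w => lossD φ w.2 (f w.1) * h w.1) P := by
  obtain ⟨C, -, hC⟩ := exists_loss_bound hφ2 (κ * ‖f‖)
  exact integrable_of_measurable_of_abs_le
    ((measurable_loss hφ2 (hH f)).2.1.mul ((hH h).comp measurable_fst))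
    (fun w => abs_mul_le_mul (hC w.2 _ (hκ f w.1)).2.1 (hκ h w.1)) P

lemma exists_clm_hessianForm {φ : ℝ → ℝ} (hφ2 : ContDiff ℝ 2 φ)
    (hH : ∀ f : H, Measurable (fun x => f x)) {κ : ℝ}
    (hκ : ∀ (f : H) (x : 𝒳), |f x| ≤ κ * ‖f‖) (lam : ℝ)
    (P : Measure (𝒳 × Label)) [IsProbabilityMeasure P] (f : H) :
    ∃ B : H →L[ℝ] H →L[ℝ] ℝ, ∀ u h, B u h = hessianForm φ lam P f u h := by
  obtain ⟨C, -, hC⟩ := exists_loss_bound hφ2 (κ * ‖f‖)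
  have hi := integrable_hessian hφ2 hH hκ P f
  let L : H →ₗ[ℝ] H →ₗ[ℝ] ℝ := LinearMap.mk₂ ℝ (hessianForm φ lam P f)
    (fun u v h => by
      simp only [hessianForm, RKHS.coe_add, Pi.add_apply, mul_add, add_mul, inner_add_left]
      rw [integral_add (hi u h) (hi v h)]; ring)
    (fun c u h => by
      simp only [hessianForm, RKHS.coe_smul, Pi.smul_apply, smul_eq_mul, real_inner_smul_left]
      rw [mul_add, ← integral_const_mul]
      congr 1
      · congr 1; funext w; ring
      · ring)
    (fun u g h => by
      simp only [hessianForm, RKHS.coe_add, Pi.add_apply, mul_add, inner_add_right]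
      rw [integral_add (hi u g) (hi u h)]; ring)
    (fun c u h => by
      simp only [hessianForm, RKHS.coe_smul, Pi.smul_apply, smul_eq_mul, real_inner_smul_right]
      rw [mul_add, ← integral_const_mul]
      congr 1
      · congr 1; funext w; ring
      · ring)
  refine ⟨L.mkContinuous₂ (C * κ * κ + |2 * lam|) fun u h => ?_, fun u h => rfl⟩
  have h1 := abs_integral_le_of_abs_le
    (fun w => abs_mul_le_mul (abs_mul_le_mul (hC w.2 _ (hκ f w.1)).2.2 (hκ u w.1))
      (hκ h w.1)) P
  have h2 := mul_le_mul_of_nonneg_left (abs_real_inner_le_norm u h) (abs_nonneg (2 * lam))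
  rw [← abs_mul] at h2
  calc ‖L u h‖ = |hessianForm φ lam P f u h| := rfl
    _ ≤ C * (κ * ‖u‖) * (κ * ‖h‖) + |2 * lam| * (‖u‖ * ‖h‖) :=
      (abs_add_le _ _).trans (add_le_add h1 h2)
    _ = _ := by ring

/-- The norm bound on the solution of the influence equation comes from testing it against itself
and replacing the mean of `φ'` through the Euler–Lagrange equation of `f`. -/
lemma norm_le_of_solvesInfluenceEq {φ : ℝ → ℝ} {κ : ℝ} (hκ0 : 0 ≤ κ)
    (hκ : ∀ (f : H) (x : 𝒳), |f x| ≤ κ * ‖f‖) {lam : ℝ} (hlam : 0 < lam)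
    {P : Measure (𝒳 × Label)} {f : H}
    (hcoer : ∀ u : H, 2 * lam * ‖u‖ ^ 2 ≤ hessianForm φ lam P f u u)
    (heuler : ∀ h : H, ∫ w, lossD φ w.2 (f w.1) * h w.1 ∂P + 2 * lam * inner ℝ f h = 0)
    {z : 𝒳 × Label} {g : H} (hg : SolvesInfluenceEq φ lam P f z g) :
    ‖g‖ ≤ ‖f‖ + κ * |lossD φ z.2 (f z.1)| / (2 * lam) := by
  have h1 := hcoer g
  have h2 : hessianForm φ lam P f g g = _ := hg g
  have h3 := heuler g
  have h4 := abs_le.1 (abs_mul_le_mul (le_refl |lossD φ z.2 (f z.1)|) (hκ g z.1))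
  have h5 := mul_le_mul_of_nonneg_left (abs_le.1 (abs_real_inner_le_norm f g)).1
    (by positivity : 0 ≤ 2 * lam)
  rcases (norm_nonneg g).eq_or_lt with h0 | h0
  · rw [← h0]; positivity
  · have : 2 * lam * ‖g‖ ≤ 2 * lam * ‖f‖ + κ * |lossD φ z.2 (f z.1)| := by
      refine le_of_mul_le_mul_right ?_ h0
      nlinarith [h4.1]
    rw [← sub_le_iff_le_add', le_div_iff₀ (by positivity)]
    linarith

variable [CompleteSpace H]

/-- The influence equation has exactly one solution as soon as the second derivative of the
regularized risk is coercive, by the Lax–Milgram theorem. -/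
lemma existsUnique_solvesInfluenceEq {φ : ℝ → ℝ} (hφ2 : ContDiff ℝ 2 φ)
    (hH : ∀ f : H, Measurable (fun x => f x)) {κ : ℝ}
    (hκ : ∀ (f : H) (x : 𝒳), |f x| ≤ κ * ‖f‖) {lam : ℝ} (hlam : 0 < lam)
    (P : Measure (𝒳 × Label)) [IsProbabilityMeasure P] {f : H}
    (hcoer : ∀ u : H, 2 * lam * ‖u‖ ^ 2 ≤ hessianForm φ lam P f u u) (z : 𝒳 × Label) :
    ∃! g : H, SolvesInfluenceEq φ lam P f z g := by
  obtain ⟨C, -, hC⟩ := exists_loss_bound hφ2 (κ * ‖f‖)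
  obtain ⟨B, hB⟩ := exists_clm_hessianForm hφ2 hH hκ lam P f
  have hBc : IsCoercive B := ⟨2 * lam, by positivity, fun u => by
    rw [hB]; have := hcoer u; linarith⟩
  have hi := integrable_lossD hφ2 hH hκ P f
  let L : H →ₗ[ℝ] ℝ :=
    { toFun := fun h => -(lossD φ z.2 (f z.1) * h z.1 - ∫ w, lossD φ w.2 (f w.1) * h w.1 ∂P)
      map_add' := fun g h => by
        simp only [RKHS.coe_add, Pi.add_apply, mul_add]
        rw [integral_add (hi g) (hi h)]; ring
      map_smul' := fun c h => by
        simp only [RKHS.coe_smul, Pi.smul_apply, smul_eq_mul, RingHom.id_apply, mul_left_comm _ c]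
        rw [integral_const_mul]; ring }
  have hbd : ∀ (h : H) (w : 𝒳 × Label), |lossD φ w.2 (f w.1) * h w.1| ≤ C * (κ * ‖h‖) :=
    fun h w => abs_mul_le_mul (hC w.2 _ (hκ f w.1)).2.1 (hκ h w.1)
  let ℓ : StrongDual ℝ H := L.mkContinuous (2 * (C * κ)) fun h => by
    have h1 := abs_integral_le_of_abs_le (hbd h) P
    have h2 := (abs_sub (lossD φ z.2 (f z.1) * h z.1)
      (∫ w, lossD φ w.2 (f w.1) * h w.1 ∂P)).trans (add_le_add (hbd h z) h1)
    calc ‖L h‖ = |lossD φ z.2 (f z.1) * h z.1 - ∫ w, lossD φ w.2 (f w.1) * h w.1 ∂P| :=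
          abs_neg _
      _ ≤ _ := h2
      _ = _ := by ring
  have hiff : ∀ g, SolvesInfluenceEq φ lam P f z g ↔
      hBc.continuousLinearEquivOfBilin g = (InnerProductSpace.toDual ℝ H).symm ℓ := by
    intro g
    rw [ext_iff_inner_right ℝ]
    refine forall_congr' fun h => ?_
    rw [hBc.continuousLinearEquivOfBilin_apply, InnerProductSpace.toDual_symm_apply, hB]
    rfl
  refine ⟨hBc.continuousLinearEquivOfBilin.symm ((InnerProductSpace.toDual ℝ H).symm ℓ), ?_, ?_⟩
  · simp [hiff]
  · intro g hg
    rw [← (hiff g).1 hg, ContinuousLinearEquiv.symm_apply_apply]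

end

/-! ### Differentiation along contaminations -/

lemma abs_apply_le_of_kernel_bound {𝒳 H : Type*} [NormedAddCommGroup H] [InnerProductSpace ℝ H]
    [RKHS ℝ H 𝒳 ℝ] [CompleteSpace H] {M : ℝ} (hM : ∀ x x' : 𝒳, |RKHS.kernel H x x' 1| ≤ M)
    (f : H) (x : 𝒳) : |f x| ≤ √M * ‖f‖ := by
  have h1 : ‖RKHS.kernel H x x‖ ≤ M := by
    refine ContinuousLinearMap.opNorm_le_bound _ ((abs_nonneg _).trans (hM x x)) fun v => ?_
    have hv : RKHS.kernel H x x v = v * RKHS.kernel H x x 1 := by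
      rw [← smul_eq_mul, ← map_smul, smul_eq_mul, mul_one]
    rw [hv, norm_mul, mul_comm]
    exact mul_le_mul_of_nonneg_right (hM x x) (norm_nonneg v)
  calc |f x| ≤ ‖f‖ * √‖RKHS.kernel H x x‖ := RKHS.norm_apply_le f x
    _ ≤ ‖f‖ * √M := by gcongr
    _ = _ := mul_comm _ _

section

variable {𝒳 : Type*} [MeasurableSpace 𝒳] {H : Type*} [NormedAddCommGroup H]
  [InnerProductSpace ℝ H] [RKHS ℝ H 𝒳 ℝ]

/-- First-order Taylor expansion of `φ'(y, ·)`, uniformly in the label and on bounded sets. -/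
lemma exists_lossD_taylor_bound {φ : ℝ → ℝ} (hφ2 : ContDiff ℝ 2 φ) (K : ℝ) {c : ℝ} (hc : 0 < c) :
    ∃ s > 0, ∀ (y : Label) (v v' : ℝ), |v| ≤ K → |v' - v| < s →
      |lossD φ y v' - lossD φ y v - lossD2 φ y v * (v' - v)| ≤ c * |v' - v| := by
  have hβ : ContDiff ℝ 1 (deriv φ) := ContDiff.deriv' hφ2
  obtain ⟨s, hs, h⟩ := exists_taylor_bound (hβ.differentiable (by norm_num))
    (hβ.continuous_deriv le_rfl) K hc
  refine ⟨s, hs, fun y v v' hv hv' => ?_⟩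
  have h1 := h (y * v) (y * (v' - v)) (by rwa [abs_mul, abs_label, one_mul])
    (by rwa [abs_mul, abs_label, one_mul])
  rw [← mul_add, add_sub_cancel, abs_mul (y : ℝ) (v' - v), abs_label, one_mul] at h1
  refine le_trans (le_of_eq ?_) h1
  have e : lossD φ y v' - lossD φ y v - lossD2 φ y v * (v' - v) =
      y * (deriv φ (y * v') - deriv φ (y * v) - deriv (deriv φ) (y * v) * (y * (v' - v))) := by
    rw [lossD_eq, lossD_eq, lossD2_eq]; ring
  rw [e, abs_mul, abs_label, one_mul]

/-- If the second derivative of the regularized risk is coercive at the minimizer and the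
minimizers of the contaminated problems converge, the influence function exists. Subtracting the
Euler–Lagrange equations of the two minimizers shows that their difference solves the influence
equation up to an error that is small compared with itself and with the contamination level. -/
lemma hasInfluence_of_solvesInfluenceEq {φ : ℝ → ℝ} (hφ2 : ContDiff ℝ 2 φ)
    (hH : ∀ f : H, Measurable (fun x => f x)) {κ : ℝ}
    (hκ : ∀ (f : H) (x : 𝒳), |f x| ≤ κ * ‖f‖) {lam : ℝ} (hlam : 0 < lam)
    (P : Measure (𝒳 × Label)) [IsProbabilityMeasure P] {T : Measure (𝒳 × Label) → H}
    (hT : ∀ Q : Measure (𝒳 × Label), IsProbabilityMeasure Q → IsRegMinimizer φ lam Q (T Q))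
    {z : 𝒳 × Label} (hlim : Tendsto (fun ε => T (contaminate P z ε)) (𝓝[>] 0) (𝓝 (T P)))
    (hcoer : ∀ u : H, 2 * lam * ‖u‖ ^ 2 ≤ hessianForm φ lam P (T P) u u)
    {g : H} (hg : SolvesInfluenceEq φ lam P (T P) z g) : HasInfluence T P z g := by
  obtain ⟨Γ, hΓ0, hΓ⟩ := exists_loss_bound hφ2 (κ * ‖T P‖)
  rw [HasInfluence, tendsto_iff_norm_sub_tendsto_zero, Metric.tendsto_nhds]
  intro r hr
  -- the Taylor error `c` is chosen so that `c κ² ≤ lam` and `c κ² ‖g‖ ≤ lam r / 2`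
  set A : ℝ := κ ^ 2 * (1 + 2 * ‖g‖ / r) + 1 with hA
  have hA0 : 0 < A := by positivity
  set c : ℝ := lam / A with hc
  have hc0 : 0 < c := by positivity
  have hcA : c * A = lam := div_mul_cancel₀ _ (by positivity)
  have hcg0 : 0 ≤ c * κ ^ 2 * (2 * ‖g‖ / r) := by positivity
  have hck0 : 0 ≤ c * κ ^ 2 := by positivity
  have hcA' : c * κ ^ 2 + c * κ ^ 2 * (2 * ‖g‖ / r) + c = lam := by rw [← hcA, hA]; ring
  have hcκ : c * κ ^ 2 ≤ lam := by linarith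
  have hcg : c * κ ^ 2 * ‖g‖ ≤ lam * (r / 2) := by
    have : c * κ ^ 2 * ‖g‖ = c * κ ^ 2 * (2 * ‖g‖ / r) * (r / 2) := by field_simp
    rw [this]
    exact mul_le_mul_of_nonneg_right (by linarith) (by positivity)
  obtain ⟨s, hs, htaylor⟩ := exists_lossD_taylor_bound hφ2 (κ * ‖T P‖) hc0
  have hd0 : Tendsto (fun ε => ‖T (contaminate P z ε) - T P‖) (𝓝[>] 0) (𝓝 0) :=
    tendsto_iff_norm_sub_tendsto_zero.1 hlim
  have hsmall1 : ∀ᶠ ε in 𝓝[>] (0 : ℝ), κ * ‖T (contaminate P z ε) - T P‖ < s := by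
    have := hd0.const_mul κ
    rw [mul_zero] at this
    exact this.eventually (gt_mem_nhds hs)
  have hsmall2 : ∀ᶠ ε in 𝓝[>] (0 : ℝ),
      2 * (Γ + c) * κ ^ 2 * ‖T (contaminate P z ε) - T P‖ < lam * (r / 2) := by
    have := hd0.const_mul (2 * (Γ + c) * κ ^ 2)
    rw [mul_zero] at this
    exact this.eventually (gt_mem_nhds (by positivity))
  have hε1 : ∀ᶠ ε in 𝓝[>] (0 : ℝ), ε < 1 :=
    (gt_mem_nhds one_pos).filter_mono nhdsWithin_le_nhds
  filter_upwards [hsmall1, hsmall2, hε1, self_mem_nhdsWithin] with ε h1 h2 hε1 hε0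
  rw [Set.mem_Ioi] at hε0
  have hprob := isProbabilityMeasure_contaminate P z hε0.le hε1.le
  set Q := contaminate P z ε with hQ
  set d : H := T Q - T P with hd
  have hdx : ∀ x, T Q x - T P x = d x := fun x => by rw [hd, RKHS.coe_sub, Pi.sub_apply]
  have hdκ : ∀ x, |d x| ≤ κ * ‖d‖ := hκ d
  -- remainder and increment of `φ'`
  have hrem : ∀ w : 𝒳 × Label, |lossD φ w.2 (T Q w.1) - lossD φ w.2 (T P w.1) -
      lossD2 φ w.2 (T P w.1) * d w.1| ≤ c * (κ * ‖d‖) := fun w => by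
    have := htaylor w.2 (T P w.1) (T Q w.1) (hκ _ _) (by
      rw [hdx]; exact (hdκ _).trans_lt h1)
    rw [hdx] at this
    exact this.trans (mul_le_mul_of_nonneg_left (hdκ _) hc0.le)
  have hinc : ∀ w : 𝒳 × Label, |lossD φ w.2 (T Q w.1) - lossD φ w.2 (T P w.1)| ≤
      (Γ + c) * (κ * ‖d‖) := fun w => by
    have e1 := abs_mul_le_mul (hΓ w.2 _ (hκ (T P) w.1)).2.2 (hdκ w.1)
    have e2 := abs_add_le (lossD φ w.2 (T Q w.1) - lossD φ w.2 (T P w.1) -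
      lossD2 φ w.2 (T P w.1) * d w.1) (lossD2 φ w.2 (T P w.1) * d w.1)
    rw [sub_add_cancel] at e2
    linarith [hrem w]
  set e : H := d - ε • g with he
  -- the linearized equation for `d`, with its error terms
  have hid : hessianForm φ lam P (T P) e e =
      -(∫ w, (lossD φ w.2 (T Q w.1) - lossD φ w.2 (T P w.1) -
        lossD2 φ w.2 (T P w.1) * d w.1) * e w.1 ∂P) +
      ε * (∫ w, (lossD φ w.2 (T Q w.1) - lossD φ w.2 (T P w.1)) * e w.1 ∂P) -
      ε * ((lossD φ z.2 (T Q z.1) - lossD φ z.2 (T P z.1)) * e z.1) := by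
    obtain ⟨D, -, hD⟩ := exists_loss_bound hφ2 (κ * ‖T Q‖)
    have eP := (hT P inferInstance).euler_lagrange hφ2 hH hκ e
    have eQ := (hT Q hprob).euler_lagrange hφ2 hH hκ e
    have eC : ∫ w, lossD φ w.2 (T Q w.1) * e w.1 ∂Q =
        (1 - ε) * ∫ w, lossD φ w.2 (T Q w.1) * e w.1 ∂P + ε * (lossD φ z.2 (T Q z.1) * e z.1) :=
      integral_contaminate P z hε0.le hε1.le
        ((measurable_loss hφ2 (hH _)).2.1.mul ((hH e).comp measurable_fst))
        (fun w => abs_mul_le_mul (hD w.2 _ (hκ _ w.1)).2.1 (hκ e w.1))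
    rw [eC] at eQ
    have eg := hg e
    obtain ⟨B, hB⟩ := exists_clm_hessianForm hφ2 hH hκ lam P (T P)
    have hlin : hessianForm φ lam P (T P) e e =
        hessianForm φ lam P (T P) d e - ε * hessianForm φ lam P (T P) g e := by
      rw [← hB, ← hB, ← hB]
      have hsub : ∀ a b : H, B (a - ε • g) b = B a b - ε * B g b := fun a b => by
        rw [map_sub, map_smul]; rfl
      exact hsub d e
    have i1 := integrable_lossD hφ2 hH hκ P (T Q) e
    have i2 := integrable_lossD hφ2 hH hκ P (T P) e
    have i3 := integrable_hessian hφ2 hH hκ P (T P) d e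
    have hinn : inner ℝ d e = inner ℝ (T Q) e - inner ℝ (T P) e := inner_sub_left _ _ _
    have r1 := integral_sub i1 i2
    have r2 := integral_sub (i1.sub i2) i3
    simp only [Pi.sub_apply] at r2
    rw [hlin, hessianForm, hessianForm, eg, hinn]
    simp only [sub_mul _ _ (e _)]
    rw [r2, r1]
    linear_combination eQ - eP
  have hb1 := abs_le.1 (abs_integral_le_of_abs_le
    (fun w => abs_mul_le_mul (hrem w) (hκ e w.1)) P)
  have hb2 := abs_le.1 (abs_integral_le_of_abs_le
    (fun w => abs_mul_le_mul (hinc w) (hκ e w.1)) P)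
  have hb3 := abs_le.1 (abs_mul_le_mul (hinc z) (hκ e z.1))
  have hmain : 2 * lam * ‖e‖ ^ 2 ≤
      (c * κ ^ 2 * ‖d‖ + ε * (2 * (Γ + c) * κ ^ 2 * ‖d‖)) * ‖e‖ := by
    refine (hcoer e).trans (hid.le.trans ?_)
    have t2 := mul_le_mul_of_nonneg_left hb2.2 hε0.le
    have t3 := mul_le_mul_of_nonneg_left hb3.1 hε0.le
    linarith [hb1.1]
  have hmain' : 2 * lam * ‖e‖ ≤ c * κ ^ 2 * ‖d‖ + ε * (2 * (Γ + c) * κ ^ 2 * ‖d‖) := by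
    rcases (norm_nonneg e).eq_or_lt with h0 | h0
    · rw [← h0, mul_zero]; positivity
    · exact le_of_mul_le_mul_right (by linarith) h0
  have hde : ‖d‖ ≤ ‖e‖ + ε * ‖g‖ := by
    have : d = e + ε • g := by rw [he, sub_add_cancel]
    calc ‖d‖ = ‖e + ε • g‖ := by rw [← this]
      _ ≤ ‖e‖ + ‖ε • g‖ := norm_add_le _ _
      _ = _ := by rw [norm_smul, Real.norm_eq_abs, abs_of_pos hε0]
  have hfin : ‖e‖ < ε * r := by
    have t1 := mul_le_mul_of_nonneg_left hde hck0
    have t2 := mul_lt_mul_of_pos_left h2 hε0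
    have t3 := mul_le_mul_of_nonneg_right hcκ (norm_nonneg e)
    have t4 := mul_le_mul_of_nonneg_left hcg hε0.le
    refine lt_of_mul_lt_mul_left (a := lam) ?_ hlam.le
    linarith
  have hquot : ∀ a : H, ε⁻¹ • a - g = ε⁻¹ • (a - ε • g) := fun a => by
    rw [smul_sub, smul_smul, inv_mul_cancel₀ hε0.ne', one_smul]
  rw [dist_zero_right, norm_norm, hquot d, ← he, norm_smul, norm_inv, Real.norm_eq_abs, abs_of_pos hε0,
    inv_mul_lt_iff₀ hε0]
  exact hfin

/-- Near the risk minimizers the second derivative of the regularized risk is coercive: its loss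
part is nonnegative and the regularization contributes `2 lam`. -/
lemma coercive_hessianForm {φ : ℝ → ℝ} (hφ2 : ContDiff ℝ 2 φ)
    (hH : ∀ f : H, Measurable (fun x => f x)) {κ : ℝ}
    (hκ : ∀ (f : H) (x : 𝒳), |f x| ≤ κ * ‖f‖) (lam : ℝ)
    {P : Measure (𝒳 × Label)} [IsProbabilityMeasure P] {η : 𝒳 → ℝ} (hη : IsClassProb P η) {f : H}
    (hpos : ∀ᵐ x ∂(P.map Prod.fst),
      0 ≤ η x * lossD2 φ 1 (f x) + (1 - η x) * lossD2 φ (-1) (f x)) (u : H) :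
    2 * lam * ‖u‖ ^ 2 ≤ hessianForm φ lam P f u u := by
  have := hη.integral_lossD2_nonneg hφ2 (hH f) ((hH u).mul (hH u)) (hκ f)
    (fun x => abs_mul_le_mul (hκ u x) (hκ u x)) (fun x => mul_self_nonneg _) hpos
  rw [hessianForm, real_inner_self_eq_norm_sq]
  simp only [mul_assoc, Pi.mul_apply] at *
  linarith

end

end ArchBoost

theorem mainTheorem3
    {𝒳 : Type*} [MeasurableSpace 𝒳]
    {H : Type*} [NormedAddCommGroup H] [InnerProductSpace ℝ H] [CompleteSpace H]
    [RKHS ℝ H 𝒳 ℝ]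
    (hH : ∀ f : H, Measurable (fun x => f x))
    (M : ℝ) (hM : ∀ x x' : 𝒳, |RKHS.kernel H x x' 1| ≤ M)
    (φ : ℝ → ℝ) (hφ : ArchBoost.IsArchLoss φ) (hφ2 : ContDiff ℝ 2 φ)
    (P : Measure (𝒳 × ArchBoost.Label)) [IsProbabilityMeasure P]
    (η : 𝒳 → ℝ) (hη : ArchBoost.IsClassProb P η)
    (δ : ℝ) (hδ0 : 0 < δ) (hδ1 : δ < 1 / 2) (hηδ : ∀ x, η x ∈ Set.Icc δ (1 - δ))
    (hconv : ∀ p ∈ Set.Icc δ (1 - δ), ∀ v : ℝ, ArchBoost.IsPointwiseMin φ p v →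
      0 < p * ArchBoost.lossD2 φ 1 v + (1 - p) * ArchBoost.lossD2 φ (-1) v)
    (Fstar : 𝒳 → ℝ) (hF : ∀ x, ArchBoost.IsPointwiseMin φ (η x) (Fstar x)) :
    ∃ r : ℝ, 0 < r ∧
      ∀ (lam : ℝ), 0 < lam →
      ∀ (T : Measure (𝒳 × ArchBoost.Label) → H),
        (∀ Q : Measure (𝒳 × ArchBoost.Label), IsProbabilityMeasure Q →
          ArchBoost.IsRegMinimizer φ lam Q (T Q)) →
        (∀ f : H, ArchBoost.IsRegMinimizer φ lam P f → f = T P) →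
        (∀ᵐ x ∂(P.map Prod.fst), |T P x - Fstar x| < r) →
        ∃ IF : 𝒳 × ArchBoost.Label → H,
          (∀ z, ArchBoost.HasInfluence T P z (IF z)) ∧
          (∀ z g, ArchBoost.SolvesInfluenceEq φ lam P (T P) z g ↔ g = IF z) ∧
          (∀ z, ‖IF z‖ ≤ √(ArchBoost.loss φ 0 0 / lam)
            + √M * |ArchBoost.lossD φ z.2 (T P z.1)| / (2 * lam)) ∧
          (1 ≤ M → ∀ z, ‖IF z‖ ≤ √(ArchBoost.loss φ 0 0 / lam)
            + M * |ArchBoost.lossD φ z.2 (T P z.1)| / (2 * lam)) ∧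
          (∃ B : ℝ, ∀ z, ‖IF z‖ ≤ B) ∧
          (∀ τ R : ℝ, (∀ v : ℝ, R ≤ |v| → |deriv φ v| ≤ τ) →
            ∀ z : 𝒳 × ArchBoost.Label, R ≤ |(z.2 : ℝ) * T P z.1| →
              ‖IF z‖ ≤ √(ArchBoost.loss φ 0 0 / lam) + √M * τ / (2 * lam)) := by
  have hγ : Continuous (deriv (deriv φ)) :=
    ContDiff.continuous_deriv (n := 1) (ContDiff.deriv' hφ2) le_rfl
  obtain ⟨r, hr, hcurv⟩ := hφ.exists_radius hγ hδ0 hconv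
  refine ⟨r, hr, fun lam hlam T hT hTP hclose => ?_⟩
  have hκ := ArchBoost.abs_apply_le_of_kernel_bound hM
  have hκ0 := Real.sqrt_nonneg M
  have hcoer := ArchBoost.coercive_hessianForm hφ2 hH hκ lam hη (f := T P)
    (hclose.mono fun x hx => (hcurv _ (hηδ x) _ (hF x) _ hx).le)
  have hsol := ArchBoost.existsUnique_solvesInfluenceEq hφ2 hH hκ hlam P hcoer
  choose IF hIF hIFu using hsol
  have heuler := (hT P inferInstance).euler_lagrange hφ2 hH hκ
  have hbound : ∀ z, ‖IF z‖ ≤ √(ArchBoost.loss φ 0 0 / lam)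
      + √M * |ArchBoost.lossD φ z.2 (T P z.1)| / (2 * lam) := fun z => by
    have h1 := ArchBoost.norm_le_of_solvesInfluenceEq hκ0 hκ hlam hcoer heuler (hIF z)
    have h2 := ArchBoost.norm_le_of_isRegMinimizer hφ.nonneg hlam (hT P inferInstance)
    linarith
  have hbound' : ∀ (z : 𝒳 × ArchBoost.Label) (τ : ℝ), |ArchBoost.lossD φ z.2 (T P z.1)| ≤ τ →
      ‖IF z‖ ≤ √(ArchBoost.loss φ 0 0 / lam) + √M * τ / (2 * lam) := fun z τ hτ =>
    (hbound z).trans (by gcongr)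
  refine ⟨IF, fun z => ?_, fun z g => ⟨hIFu z g, fun h => h ▸ hIF z⟩, hbound, fun hM1 z => ?_, ?_,
    fun τ R hτ z hz => hbound' z τ ?_⟩
  · exact ArchBoost.hasInfluence_of_solvesInfluenceEq hφ2 hH hκ hlam P hT
      (ArchBoost.tendsto_minimizer hφ.nonneg hφ2 hH hκ0 hκ hlam P hT hTP z) hcoer (hIF z)
  · refine (hbound z).trans ?_
    gcongr
    exact Real.sqrt_le_self_iff.2 (Or.inr hM1)
  · obtain ⟨C, -, hC⟩ := ArchBoost.exists_loss_bound hφ2 (√M * ‖T P‖)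
    exact ⟨_, fun z => hbound' z C (hC z.2 _ (hκ _ _)).2.1⟩
  · rw [ArchBoost.abs_lossD]
    exact hτ _ hz
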